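/- Let $(a_n)_{n\in\mathbb Z}$, $(p_n)_{n\in\mathbb Z}$, $(q_n)_{n\in\mathbb Z}$ be complex sequences with $a_n\neq 0$ for all $n$ and $\sum_{n\in\mathbb Z}|n|\,(|1-a_n|+|p_n|+|q_n|)<\infty$, and let $L_\lambda$ be the quadratic pencil of difference operators in $\ell^2(\mathbb Z)$ given by $$(L_\lambda y)_n=\Delta(a_{n-1}\Delta y_{n-1})+(q_n+2\lambda p_n+\lambda^2)y_n,\qquad n\in\mathbb Z,$$ where $\Delta$ is the forward difference operator. A number $\lambda\in\mathbb C$ is an eigenvalue of $L_\lambda$ if $L_\lambda y=0$ for some nonzero $y\in\ell^2(\mathbb Z)$. For $\operatorname{Im}z\ge 0$ let $f^{\pm}(z)$ be the Jost solutions, i.e. the solutions of $L_\lambda f=0$ with $\lambda=2\cos\frac z2$ and $f^{\pm}_n(z)=(-1)^n e^{\pm inz}(1+o(1))$ as $n\to\pm\infty$, and let $\Phi(z)=a_n\,(f^-_n(z)f^+_{n+1}(z)-f^-_{n+1}(z)f^+_n(z))$ be their Wronskian (it does not depend on $n$; it is the denominator of the kernel of the resolvent $L_\lambda^{-1}$).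 The set of spectral singularities is $$\sigma_{ss}=\{\lambda=2\cos\tfrac z2:\ z\in[-\pi,3\pi],\ \Phi(z)=0\}\subset[-2,2],$$ and $\sigma_{ss}^{\circ}$ denotes the set obtained when $z$ is restricted to $P_0=(-\pi,3\pi)\setminus\{0,\pi,2\pi\}$, that is, $\sigma_{ss}$ without the thresholds $-2,0,2$. Then: 1. The set of eigenvalues of $L_\lambda$ is bounded and countable, and its accumulation points lie in $[-2,2]$. 2. The set $\sigma_{ss}$ of spectral singularities is closed and has (one-dimensional) Lebesgue measure zero. 3. The set $\sigma_{ss}^{\circ}$ has Lebesgue measure zero, and its closure is contained in $\sigma_{ss}^{\circ}\cup\{-2,0,2\}$. -/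

import Mathlib

open Filter Topology MeasureTheory

namespace DiffPencil

/-- The difference expression
`(L_λ y)_n = Δ(a_{n-1} Δ y_{n-1}) + (q_n + 2 λ p_n + λ²) y_n`, `n ∈ ℤ`,
where `Δ` is the forward difference operator. -/
def pencil (a p q : ℤ → ℂ) (lam : ℂ) (y : ℤ → ℂ) (n : ℤ) : ℂ :=
  fwdDiff 1 (fun m : ℤ => a (m - 1) * fwdDiff 1 y (m - 1)) n
    + (q n + 2 * lam * p n + lam ^ 2) * y n

/-- `y` solves the equation `L_λ y = 0` on all of `ℤ`. -/
def IsSolution (a p q : ℤ → ℂ) (lam : ℂ) (y : ℤ → ℂ) : Prop :=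
  ∀ n : ℤ, pencil a p q lam y n = 0

/-- The eigenvalues of the pencil `L_λ` in `ℓ²(ℤ)`: those `λ ∈ ℂ` for which `L_λ y = 0` has a
nonzero solution `y ∈ ℓ²(ℤ)`. -/
def eigenvalues (a p q : ℤ → ℂ) : Set ℂ :=
  {lam | ∃ y : lp (fun _ : ℤ => ℂ) 2, y ≠ 0 ∧ IsSolution a p q lam (fun n => y n)}

/-- The Wronskian `W[u, v]_n = a_n (u_n v_{n+1} - u_{n+1} v_n)`; for two solutions of
`L_λ y = 0` it does not depend on `n`. -/
def wronskian (a u v : ℤ → ℂ) (n : ℤ) : ℂ :=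
  a n * (u n * v (n + 1) - u (n + 1) * v n)

/-- `f` is the Jost solution at `+∞` for the parameter `z`, `Im z ≥ 0`: it solves `L_λ f = 0` with
`λ = 2 cos (z / 2)` and `f_n = (-1)^n exp (i n z) (1 + o(1))` as `n → ∞`. -/
def IsJostPlus (a p q : ℤ → ℂ) (z : ℂ) (f : ℤ → ℂ) : Prop :=
  IsSolution a p q (2 * Complex.cos (z / 2)) f ∧
    Tendsto (fun n : ℤ => (-1 : ℂ) ^ n * Complex.exp (-(Complex.I * n * z)) * f n) atTop (𝓝 1)

/-- `f` is the Jost solution at `-∞` for the parameter `z`, `Im z ≥ 0`: it solves `L_λ f = 0` with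
`λ = 2 cos (z / 2)` and `f_n = (-1)^n exp (-i n z) (1 + o(1))` as `n → -∞`. -/
def IsJostMinus (a p q : ℤ → ℂ) (z : ℂ) (f : ℤ → ℂ) : Prop :=
  IsSolution a p q (2 * Complex.cos (z / 2)) f ∧
    Tendsto (fun n : ℤ => (-1 : ℂ) ^ n * Complex.exp (Complex.I * n * z) * f n) atBot (𝓝 1)

open Classical in
/-- The Jost solution `f⁺(z)` (the zero sequence if there were none). -/
noncomputable def jostPlus (a p q : ℤ → ℂ) (z : ℂ) : ℤ → ℂ :=
  if h : ∃ f, IsJostPlus a p q z f then h.choose else 0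

open Classical in
/-- The Jost solution `f⁻(z)` (the zero sequence if there were none). -/
noncomputable def jostMinus (a p q : ℤ → ℂ) (z : ℂ) : ℤ → ℂ :=
  if h : ∃ f, IsJostMinus a p q z f then h.choose else 0

/-- `Φ(z) = W[f⁻(z), f⁺(z)]`, the denominator of the kernel of the resolvent `L_λ⁻¹`,
`λ = 2 cos (z / 2)`. -/
noncomputable def Phi (a p q : ℤ → ℂ) (z : ℂ) : ℂ :=
  wronskian a (jostMinus a p q z) (jostPlus a p q z) 0

/-- The spectral singularities: the points `λ = 2 cos (z / 2)` of the continuous spectrum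
`[-2, 2]`, `z ∈ [-π, 3π]`, at which the denominator `Φ` of the kernel of the resolvent vanishes. -/
noncomputable def spectralSingularities (a p q : ℤ → ℂ) : Set ℝ :=
  {lam | ∃ z ∈ Set.Icc (-Real.pi) (3 * Real.pi),
    lam = 2 * Real.cos (z / 2) ∧ Phi a p q (z : ℂ) = 0}

/-- The spectral singularities with the thresholds `λ = -2, 0, 2` left out: the points
`λ = 2 cos (z / 2)` with `Φ(z) = 0` and `z ∈ P₀ = (-π, 3π) \ {0, π, 2π}`. -/
noncomputable def spectralSingularitiesOffThresholds (a p q : ℤ → ℂ) : Set ℝ :=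
  {lam | ∃ z ∈ Set.Ioo (-Real.pi) (3 * Real.pi) \ {0, Real.pi, 2 * Real.pi},
    lam = 2 * Real.cos (z / 2) ∧ Phi a p q (z : ℂ) = 0}

end DiffPencil

namespace DiffPencil

open Metric

/-! Everything is read in the variable `s = exp (I z / 2)`. Then `λ = s + s⁻¹`, the half-plane `Im z
> 0` goes to the punctured open unit disc and real `z` to the unit circle. Writing the Jost solution
as `(-s²)^n g_n` turns the equation into a recurrence whose coefficients are polynomials in `s`, so
it also makes sense at `s = 0`. The first-moment condition makes the resulting summation equation
contractive far out, uniformly in `s`. Solving it in the disc algebra, with `s` the coordinate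
function, gives `g_n` holomorphic in the disc and continuous up to the circle at one stroke
(`exists_reduced_jost_on_disc`). Reflection `n ↦ -n` gives the other end, and `s² Φ` becomes a
function `G` of the same class with `G 0 ≠ 0` (`exists_disc_function`).

An eigenfunction decays at both ends, so it is a multiple of both Jost solutions; eigenvalues thus
come from zeros of `G` in the open disc. These are isolated and stay away from `0`, which gives
claim 1 through the map `s ↦ s + s⁻¹`. Spectral singularities are the values `2 Re s` at zeros of
`G` on the circle: a compact set, null by Jensen's inequality (`volume_circle_zeros_eq_zero`). Claim
3 follows since dropping the thresholds removes at most three points of a closed null set. -/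

/-! ### Reduced Jost solutions over a Banach algebra. -/

/-- The right-hand side is a contraction of the bounded sequences in sup norm, with constant `∑ ρ
m`. -/
theorem exists_bounded_eq_one_add_tsum {A : Type*} [NormedRing A] [CompleteSpace A]
    (κ : ℕ → ℕ → A) (ρ : ℕ → ℝ) (hκ : ∀ n m, ‖κ n m‖ ≤ ρ m) (hρ : Summable ρ)
    (hlt : ∑' m, ρ m < 1) :
    ∃ (g : ℕ → A) (C : ℝ), (∀ n, ‖g n‖ ≤ C) ∧ ∀ n, g n = 1 + ∑' m, κ n m * g m := by
  have hρ0 : ∀ m, 0 ≤ ρ m := fun m => (norm_nonneg _).trans (hκ 0 m)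
  have hb : ∀ (x : ℕ → A) (C : ℝ), (∀ n, ‖x n‖ ≤ C) → ∀ n m, ‖κ n m * x m‖ ≤ ρ m * C :=
    fun x C hx n m => (norm_mul_le _ _).trans
      (mul_le_mul (hκ n m) (hx m) (norm_nonneg _) (hρ0 m))
  have hs : ∀ (x : ℕ → A) (C : ℝ), (∀ n, ‖x n‖ ≤ C) → ∀ n, Summable fun m => κ n m * x m :=
    fun x C hx n => Summable.of_norm_bounded (hρ.mul_right C) (hb x C hx n)
  have hn : ∀ (x : ℕ → A) (C : ℝ), (∀ n, ‖x n‖ ≤ C) → ∀ n,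
      ‖∑' m, κ n m * x m‖ ≤ (∑' m, ρ m) * C := fun x C hx n =>
    tsum_of_norm_bounded (hρ.hasSum.mul_right C) (hb x C hx n)
  let T : (BoundedContinuousFunction ℕ A) → BoundedContinuousFunction ℕ A := fun x =>
    BoundedContinuousFunction.ofNormedAddCommGroupDiscrete (fun n => 1 + ∑' m, κ n m * x m)
      (‖(1 : A)‖ + (∑' m, ρ m) * ‖x‖)
      (fun n => (norm_add_le _ _).trans (by gcongr; exact hn x ‖x‖ x.norm_coe_le_norm n))
  have hT : ContractingWith (∑' m, ρ m).toNNReal T := by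
    refine ⟨by simpa using hlt, LipschitzWith.of_dist_le_mul fun x y => ?_⟩
    rw [Real.coe_toNNReal _ (tsum_nonneg hρ0)]
    rw [BoundedContinuousFunction.dist_le (mul_nonneg (tsum_nonneg hρ0) dist_nonneg)]
    intro n
    have h1 : T x n - T y n = ∑' m, κ n m * (x - y) m := by
      change (1 + ∑' m, κ n m * x m) - (1 + ∑' m, κ n m * y m) = _
      rw [add_sub_add_left_eq_sub, ← (hs x _ x.norm_coe_le_norm n).tsum_sub
        (hs y _ y.norm_coe_le_norm n)]
      simp [mul_sub]
    rw [dist_eq_norm, h1, dist_eq_norm]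
    exact hn (x - y) _ (x - y).norm_coe_le_norm n
  let g : BoundedContinuousFunction ℕ A := ContractingWith.fixedPoint T hT
  refine ⟨g, _, g.norm_coe_le_norm, fun n => ?_⟩
  change g n = T g n
  rw [show T g = g from hT.fixedPoint_isFixedPt]

/-- With `d n = a n • (g n - g (n + 1))` the relation is `d n = e (n + 1) * g (n + 1) + w * d (n +
1)`. Summing it twice from infinity gives `g = 1 + ∑ κ g`; the kernel has `m - n` terms, each at
most `B ‖e m‖` because `‖w‖ ≤ 1`, hence the weight `m`. -/
theorem exists_tendsto_one_of_small {A : Type*} [NormedCommRing A] [NormedAlgebra ℂ A]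
    [CompleteSpace A] [NormOneClass A] (a : ℕ → ℂ) (e : ℕ → A) (w : A) (hw : ‖w‖ ≤ 1) (B : ℝ)
    (ha : ∀ k, a k ≠ 0) (haB : ∀ k, ‖(a k)⁻¹‖ ≤ B) (he : Summable fun m : ℕ => B * m * ‖e m‖)
    (hsmall : ∑' m : ℕ, B * m * ‖e m‖ < 1) :
    ∃ g : ℕ → A, Tendsto g atTop (𝓝 1) ∧ ∀ n, a n • (g n - g (n + 1)) =
      e (n + 1) * g (n + 1) + w * (a (n + 1) • (g (n + 1) - g (n + 2))) := by
  have hB : 0 ≤ B := (norm_nonneg _).trans (haB 0)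
  have hwp : ∀ j, ‖w ^ j‖ ≤ 1 := fun j => (norm_pow_le _ _).trans (pow_le_one₀ (norm_nonneg _) hw)
  let κ : ℕ → ℕ → A := fun n m => ∑ k ∈ Finset.Ico n m, (a k)⁻¹ • (w ^ (m - k - 1) * e m)
  have hterm : ∀ k j m, ‖(a k)⁻¹ • (w ^ j * e m)‖ ≤ B * ‖e m‖ := fun k j m => by
    rw [norm_smul]
    refine mul_le_mul (haB k) ?_ (norm_nonneg _) hB
    exact (norm_mul_le _ _).trans (mul_le_of_le_one_left (norm_nonneg _) (hwp j))
  have hκ : ∀ n m, ‖κ n m‖ ≤ B * m * ‖e m‖ := fun n m => by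
    refine (norm_sum_le_of_le _ fun k _ => hterm k _ m).trans ?_
    rw [Finset.sum_const, Nat.card_Ico, nsmul_eq_mul]
    have : ((m - n : ℕ) : ℝ) ≤ m := by exact_mod_cast Nat.sub_le m n
    calc ((m - n : ℕ) : ℝ) * (B * ‖e m‖) ≤ m * (B * ‖e m‖) := by gcongr
      _ = _ := by ring
  obtain ⟨g, C, hC, hg⟩ := exists_bounded_eq_one_add_tsum κ _ hκ he hsmall
  have hdom : ∀ n m, ‖κ n m * g m‖ ≤ B * m * ‖e m‖ * C := fun n m =>
    (norm_mul_le _ _).trans (mul_le_mul (hκ n m) (hC m) (norm_nonneg _) (by positivity))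
  have hsm : ∀ n, Summable fun m => κ n m * g m := fun n =>
    Summable.of_norm_bounded (he.mul_right C) (hdom n)
  -- The terms of the series for `d n`, which is the first difference of the double sum.
  let t : ℕ → ℕ → A := fun n m => if n < m then w ^ (m - n - 1) * e m * g m else 0
  have hstep : ∀ n m, κ n m * g m - κ (n + 1) m * g m = (a n)⁻¹ • t n m := fun n m => by
    by_cases h : n < m
    · simp only [κ, t, if_pos h]
      rw [Finset.sum_eq_sum_Ico_succ_bot h, add_mul, add_sub_cancel_right, smul_mul_assoc]
    · have h' : m ≤ n := not_lt.mp h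
      simp [κ, t, if_neg h, Finset.Ico_eq_empty_of_le h', Finset.Ico_eq_empty_of_le (h'.trans n.le_succ)]
  have hgd : ∀ n, a n • (g n - g (n + 1)) = ∑' m, t n m := fun n => by
    conv_lhs => rw [hg n, hg (n + 1), add_sub_add_left_eq_sub, ← (hsm n).tsum_sub (hsm (n + 1))]
    simp only [hstep]
    rw [tsum_const_smul'', smul_smul, mul_inv_cancel₀ (ha n), one_smul]
  have hts : ∀ n, Summable (t n) := fun n => by
    have := ((hsm n).sub (hsm (n + 1))).const_smul (a n)
    simpa only [hstep, smul_smul, mul_inv_cancel₀ (ha n), one_smul] using this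
  refine ⟨g, ?_, fun n => ?_⟩
  · have h0 : Tendsto (fun n => ∑' m, κ n m * g m) atTop (𝓝 (∑' _ : ℕ, (0 : A))) := by
      refine tendsto_tsum_of_dominated_convergence (he.mul_right C) (fun m => ?_)
        (Eventually.of_forall hdom)
      refine tendsto_const_nhds.congr' ?_
      filter_upwards [eventually_ge_atTop m] with n hn
      simp [κ, Finset.Ico_eq_empty_of_le hn]
    have := h0.const_add (1 : A)
    rw [tsum_zero, add_zero] at this
    exact this.congr fun n => (hg n).symm
  · have hrec : ∀ m, t n m = (if m = n + 1 then e (n + 1) * g (n + 1) else 0) + w * t (n + 1) m :=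
      fun m => by
      rcases lt_trichotomy m (n + 1) with h | h | h
      · simp [t, h.ne, show ¬ n < m by omega, show ¬ n + 1 < m by omega]
      · subst h; simp [t]
      · simp only [t, if_pos h, if_pos (show n < m by omega), if_neg h.ne', zero_add]
        rw [show m - n - 1 = (m - (n + 1) - 1) + 1 by omega, pow_succ']
        ring
    rw [hgd n, hgd (n + 1)]
    simp_rw [hrec]
    rw [Summable.tsum_add (summable_of_ne_finset_zero (s := {n + 1}) (by simp +contextual))
      ((hts (n + 1)).mul_left w), tsum_ite_eq, (hts (n + 1)).tsum_mul_left]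

/-- A solution of a three-term recurrence on a half-line extends to all of `ℤ`. -/
theorem exists_extension_of_recurrence {A : Type*} (Q : ℤ → A → A → A → Prop)
    (step : ∀ n y z, ∃ x, Q n x y z) (N : ℤ) (g : ℕ → A)
    (hg : ∀ k : ℕ, Q (N + k + 1) (g k) (g (k + 1)) (g (k + 2))) :
    ∃ G : ℤ → A, (∀ k : ℕ, G (N + k) = g k) ∧ ∀ n, Q n (G (n - 1)) (G n) (G (n + 1)) := by
  choose f hf using step
  -- After `k` backward steps the state holds the values at `N - k` and `N - k + 1`.
  let st : ℕ → A × A := fun k =>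
    Nat.rec (g 0, g 1) (fun j x => (f (N - j) x.1 x.2, x.1)) k
  let G : ℤ → A := fun n => if N ≤ n then g (n - N).toNat else (st (N - n).toNat).1
  have hst : ∀ k : ℕ, G (N - k) = (st k).1 := fun k => by
    rcases k with _ | k
    · simp [G, st]
    · simp only [G]
      rw [if_neg (by push_cast; omega), show (N - (N - ((k + 1 : ℕ) : ℤ))).toNat = k + 1 by omega]
  have hge : ∀ k : ℕ, G (N + k) = g k := fun k => by simp [G]
  have hst2 : ∀ k : ℕ, G (N - k + 1) = (st k).2 := fun k => by
    rcases k with _ | k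
    · simpa [st] using hge 1
    · have : N - ((k + 1 : ℕ) : ℤ) + 1 = N - k := by push_cast; ring
      rw [this, hst]
  refine ⟨G, hge, fun n => ?_⟩
  rcases le_or_gt n N with h | h
  · obtain ⟨k, hk⟩ := Int.eq_ofNat_of_zero_le (sub_nonneg.mpr h)
    obtain rfl : n = N - k := by omega
    have h1 : N - (k : ℤ) - 1 = N - ((k + 1 : ℕ) : ℤ) := by push_cast; ring
    rw [hst2, hst, h1, hst]
    exact hf _ _ _
  · obtain ⟨k, hk⟩ := Int.eq_ofNat_of_zero_le (show 0 ≤ n - N - 1 by omega)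
    obtain rfl : n = N + k + 1 := by omega
    have h1 : N + (k : ℤ) + 1 - 1 = N + k := by ring
    have h2 : N + (k : ℤ) + 1 = N + ((k + 1 : ℕ) : ℤ) := by push_cast; ring
    have h3 : N + (k : ℤ) + 1 + 1 = N + ((k + 2 : ℕ) : ℤ) := by push_cast; ring
    rw [h1, h3, hge, hge]
    have := hg k
    rw [h2] at this ⊢
    rwa [hge]

theorem summable_natCast_mul_norm_tail_small {A : Type*} [NormedRing A] (e : ℕ → A) (B : ℝ)
    (hB : 0 ≤ B) (he : Summable fun m : ℕ => (m : ℝ) * ‖e m‖) :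
    ∀ᶠ N : ℕ in atTop, (Summable fun m : ℕ => B * m * ‖e (m + N)‖) ∧
      ∑' m : ℕ, B * m * ‖e (m + N)‖ < 1 := by
  have he' : Summable fun m : ℕ => B * ((m : ℝ) * ‖e m‖) := he.mul_left B
  have hlim := tendsto_sum_nat_add fun m : ℕ => B * ((m : ℝ) * ‖e m‖)
  filter_upwards [hlim.eventually (gt_mem_nhds one_pos)] with N hN
  have hle : ∀ m : ℕ, B * m * ‖e (m + N)‖ ≤ B * (((m + N : ℕ) : ℝ) * ‖e (m + N)‖) := fun m => by
    rw [mul_assoc]; gcongr; omega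
  have h1 : Summable fun m : ℕ => B * (((m + N : ℕ) : ℝ) * ‖e (m + N)‖) :=
    (summable_nat_add_iff (f := fun m : ℕ => B * ((m : ℝ) * ‖e m‖)) N).mpr he'
  have h2 : Summable fun m : ℕ => B * m * ‖e (m + N)‖ :=
    Summable.of_nonneg_of_le (fun m => by positivity) hle h1
  exact ⟨h2, (h2.tsum_le_tsum hle h1).trans_lt hN⟩

/-- The Jost solution at `+∞`, with the factor `(-1)^n s^(2n)` removed. -/
theorem exists_reduced_jost {A : Type*} [NormedCommRing A] [NormedAlgebra ℂ A]
    [CompleteSpace A] [NormOneClass A] (a p q : ℤ → ℂ) (ha : ∀ n, a n ≠ 0)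
    (hsum : Summable fun n : ℕ => (n : ℝ) * (‖1 - a n‖ + ‖p n‖ + ‖q n‖)) (s : A) (hs : ‖s‖ ≤ 1) :
    ∃ g : ℤ → A, Tendsto g atTop (𝓝 1) ∧ ∀ n, a (n - 1) • g (n - 1) + s ^ 4 * (a n • g (n + 1)) =
      (1 + s ^ 4) * g n + (q n + (1 - a n) + (1 - a (n - 1))) • (s ^ 2 * g n)
        + (2 * p n) • ((s ^ 3 + s) * g n) := by
  have hsp : ∀ j, ‖s ^ j‖ ≤ 1 := fun j => (norm_pow_le _ _).trans (pow_le_one₀ (norm_nonneg _) hs)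
  -- The remainder after rewriting the recurrence as `a (n-1) (g (n-1) - g n) = s⁴ a n (g n - g
  -- (n+1)) + e n * g n`.
  let e : ℤ → A := fun n => (q n + (1 - a n) + (1 - a (n - 1))) • s ^ 2
    + (2 * p n) • (s ^ 3 + s) + (1 - a (n - 1)) • 1 + (1 - a n) • s ^ 4
  have hbound : ∀ n, ‖e n‖ ≤ 4 * (‖1 - a n‖ + ‖p n‖ + ‖q n‖) + 2 * ‖1 - a (n - 1)‖ := fun n => by
    have h1 : ‖(q n + (1 - a n) + (1 - a (n - 1))) • s ^ 2‖ ≤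
        (‖q n‖ + ‖1 - a n‖ + ‖1 - a (n - 1)‖) * 1 := by
      rw [norm_smul]
      exact mul_le_mul norm_add₃_le (hsp 2) (norm_nonneg _) (by positivity)
    have h2 : ‖(2 * p n) • (s ^ 3 + s)‖ ≤ (2 * ‖p n‖) * 2 := by
      rw [norm_smul, norm_mul]
      refine mul_le_mul (by simp) ((norm_add_le _ _).trans ?_) (norm_nonneg _) (by positivity)
      linarith [hsp 3]
    have h3 : ‖(1 - a (n - 1)) • (1 : A)‖ ≤ ‖1 - a (n - 1)‖ := by rw [norm_smul]; simp
    have h4 : ‖(1 - a n) • s ^ 4‖ ≤ ‖1 - a n‖ * 1 := by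
      rw [norm_smul]; exact mul_le_mul_of_nonneg_left (hsp 4) (norm_nonneg _)
    have h5 := norm_add_le ((q n + (1 - a n) + (1 - a (n - 1))) • s ^ 2
      + (2 * p n) • (s ^ 3 + s) + (1 - a (n - 1)) • 1) ((1 - a n) • s ^ 4)
    have h6 : ‖(q n + (1 - a n) + (1 - a (n - 1))) • s ^ 2
      + (2 * p n) • (s ^ 3 + s) + (1 - a (n - 1)) • (1 : A)‖ ≤ _ := norm_add₃_le
    have := norm_nonneg (q n)
    have := norm_nonneg (1 - a n)
    change ‖(q n + (1 - a n) + (1 - a (n - 1))) • s ^ 2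
      + (2 * p n) • (s ^ 3 + s) + (1 - a (n - 1)) • 1 + (1 - a n) • s ^ 4‖ ≤ _
    linarith
  have hsa : Summable fun n : ℕ => (n : ℝ) * ‖1 - a n‖ :=
    Summable.of_nonneg_of_le (fun n => by positivity) (fun n => by
      gcongr; linarith [norm_nonneg (p n), norm_nonneg (q n)]) hsum
  have hsa' : Summable fun n : ℕ => (n : ℝ) * ‖1 - a ((n : ℤ) - 1)‖ := by
    rw [← summable_nat_add_iff 2]
    refine Summable.of_nonneg_of_le (fun n => by positivity) (fun n => ?_)
      (((summable_nat_add_iff 1).mpr hsa).mul_left 2)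
    rw [show ((n + 2 : ℕ) : ℤ) - 1 = ((n + 1 : ℕ) : ℤ) by push_cast; ring, ← mul_assoc]
    gcongr
    push_cast
    linarith [Nat.cast_nonneg (α := ℝ) n]
  have hse : Summable fun n : ℕ => (n : ℝ) * ‖e n‖ := by
    refine Summable.of_nonneg_of_le (fun n => by positivity) (fun n => ?_)
      ((hsum.mul_left 4).add (hsa'.mul_left 2))
    calc (n : ℝ) * ‖e n‖ ≤ n * (4 * (‖1 - a n‖ + ‖p n‖ + ‖q n‖) + 2 * ‖1 - a ((n : ℤ) - 1)‖) := by
          gcongr; exact hbound n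
      _ = _ := by ring
  have ha1 : ∀ᶠ n : ℕ in atTop, ‖(a n)⁻¹‖ ≤ 2 := by
    filter_upwards [hsa.tendsto_atTop_zero.eventually (gt_mem_nhds (show (0 : ℝ) < 1 / 2 by norm_num)),
      eventually_ge_atTop 1] with n hn h1
    have h1' : (1 : ℝ) ≤ n := by exact_mod_cast h1
    have h2 : ‖1 - a n‖ ≤ 1 / 2 := by nlinarith [norm_nonneg (1 - a n)]
    have h3 : (1 : ℝ) / 2 ≤ ‖a n‖ := by
      have := norm_sub_norm_le (1 : ℂ) (a n)
      rw [norm_one] at this; linarith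
    rw [norm_inv]
    exact (inv_anti₀ (by norm_num) h3).trans (by norm_num)
  -- Beyond `N` the fixed-point equation is contractive; the values below `N` come from solving the
  -- recurrence backwards, possible since `a (n - 1) ≠ 0`.
  obtain ⟨N, hN1, hN2⟩ := ((eventually_forall_ge_atTop.mpr ha1).and
    (summable_natCast_mul_norm_tail_small (fun m : ℕ => e m) 2 zero_le_two hse)).exists
  have hN3 := hN2.1
  obtain ⟨g, hg1, hg⟩ := exists_tendsto_one_of_small (fun k => a ((k + N : ℕ) : ℤ))
    (fun k => e ((k + N : ℕ) : ℤ)) (s ^ 4) (hsp 4) 2 (fun k => ha _) (fun k => hN1 _ (by omega))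
    hN3 hN2.2
  let Q : ℤ → A → A → A → Prop := fun n x y z => a (n - 1) • x + s ^ 4 * (a n • z) =
      (1 + s ^ 4) * y + (q n + (1 - a n) + (1 - a (n - 1))) • (s ^ 2 * y)
        + (2 * p n) • ((s ^ 3 + s) * y)
  obtain ⟨G, hG, hQ⟩ := exists_extension_of_recurrence Q (fun n y z =>
    ⟨(a (n - 1))⁻¹ • ((1 + s ^ 4) * y + (q n + (1 - a n) + (1 - a (n - 1))) • (s ^ 2 * y)
        + (2 * p n) • ((s ^ 3 + s) * y) - s ^ 4 * (a n • z)), by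
      simp only [Q]
      rw [smul_smul, mul_inv_cancel₀ (ha _), one_smul, sub_add_cancel]⟩) N g (fun k => by
      have h := hg k

      have e2 : (N : ℤ) + k + 1 = ((k + 1 + N : ℕ) : ℤ) := by push_cast; ring
      have e3 : ((k + 1 + N : ℕ) : ℤ) - 1 = ((k + N : ℕ) : ℤ) := by push_cast; ring
      simp only [Q, e, e2, e3] at h ⊢
      simp only [Algebra.smul_def, map_add, map_sub, map_one] at h ⊢
      linear_combination h)
  refine ⟨G, ?_, hQ⟩
  have htn : Tendsto (fun n : ℤ => (n - N).toNat) atTop atTop :=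
    tendsto_atTop.mpr fun b => by
      filter_upwards [eventually_ge_atTop ((N : ℤ) + b)] with n hn
      omega
  refine (hg1.comp htn).congr' ?_
  filter_upwards [eventually_ge_atTop (N : ℤ)] with n hn
  rw [Function.comp_apply, ← hG]
  congr 1
  omega

/-! ### Holomorphic dependence on `s`. -/

/-- The disc algebra: continuous functions on the closed unit disc, holomorphic inside. -/
noncomputable def discAlgebra : Subalgebra ℂ C(closedBall (0 : ℂ) 1, ℂ) where
  carrier := {f | DifferentiableOn ℂ (Function.extend Subtype.val f 0) (ball 0 1)}
  mul_mem' {f g} hf hg := (DifferentiableOn.mul hf hg).congr fun x hx => by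
    have key (f : C(closedBall (0 : ℂ) 1, ℂ)) :=
      Subtype.val_injective.extend_apply f 0 ⟨x, ball_subset_closedBall hx⟩
    exact (key (f * g)).trans (congrArg₂ (· * ·) (key f) (key g)).symm
  add_mem' {f g} hf hg := (DifferentiableOn.add hf hg).congr fun x hx => by
    have key (f : C(closedBall (0 : ℂ) 1, ℂ)) :=
      Subtype.val_injective.extend_apply f 0 ⟨x, ball_subset_closedBall hx⟩
    exact (key (f + g)).trans (congrArg₂ (· + ·) (key f) (key g)).symm
  algebraMap_mem' c := (differentiableOn_const c).congr fun x hx => by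
    exact Subtype.val_injective.extend_apply (algebraMap ℂ C(closedBall (0 : ℂ) 1, ℂ) c) 0
      ⟨x, ball_subset_closedBall hx⟩

/-- Locally uniform limits of holomorphic functions are holomorphic; this makes the disc algebra
complete, as the fixed-point argument requires. -/
theorem isClosed_discAlgebra : IsClosed (discAlgebra : Set C(closedBall (0 : ℂ) 1, ℂ)) := by
  refine isClosed_of_closure_subset fun f hf => ?_
  obtain ⟨u, hu, hlim⟩ := mem_closure_iff_seq_limit.mp hf
  rw [ContinuousMap.tendsto_iff_tendstoUniformly] at hlim
  refine TendstoLocallyUniformlyOn.differentiableOn (φ := atTop)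
    (F := fun i => Function.extend Subtype.val (u i) 0) (TendstoUniformlyOn.tendstoLocallyUniformlyOn ?_)
    (Eventually.of_forall hu) isOpen_ball
  intro U hU
  filter_upwards [hlim U hU] with i hi x hx
  have key (f : C(closedBall (0 : ℂ) 1, ℂ)) :=
    Subtype.val_injective.extend_apply f 0 ⟨x, ball_subset_closedBall hx⟩
  simp only at key
  rw [key, key]
  exact hi _

theorem exists_reduced_jost_on_disc (a p q : ℤ → ℂ) (ha : ∀ n, a n ≠ 0)
    (hsum : Summable fun n : ℕ => (n : ℝ) * (‖1 - a n‖ + ‖p n‖ + ‖q n‖)) :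
    ∃ g : ℤ → ℂ → ℂ, (∀ n, DiffContOnCl ℂ (g n) (ball 0 1)) ∧ ∀ s ∈ closedBall (0 : ℂ) 1,
      Tendsto (fun n => g n s) atTop (𝓝 1) ∧
      ∀ n, a (n - 1) * g (n - 1) s + s ^ 4 * (a n * g (n + 1) s) =
        (1 + s ^ 4) * g n s + (q n + (1 - a n) + (1 - a (n - 1))) * (s ^ 2 * g n s)
          + (2 * p n) * ((s ^ 3 + s) * g n s) := by
  have : CompleteSpace discAlgebra := isClosed_discAlgebra.completeSpace_coe
  have : Nonempty (closedBall (0 : ℂ) 1) := ⟨⟨0, by simp⟩⟩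
  have : NormOneClass discAlgebra := ⟨norm_one (α := C(closedBall (0 : ℂ) 1, ℂ))⟩
  -- The coordinate function plays the role of `s`; evaluation at a point then recovers the scalar
  -- recurrence and limit.
  let s₀ : C(closedBall (0 : ℂ) 1, ℂ) := ⟨Subtype.val, continuous_subtype_val⟩
  have hs₀ : s₀ ∈ discAlgebra := differentiableOn_id.congr fun x hx =>
    Subtype.val_injective.extend_apply s₀ 0 ⟨x, ball_subset_closedBall hx⟩
  obtain ⟨g, hg, hrec⟩ := exists_reduced_jost a p q ha hsum (⟨s₀, hs₀⟩ : discAlgebra) (by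
    change ‖s₀‖ ≤ 1
    exact (ContinuousMap.norm_le _ zero_le_one).mpr fun x => mem_closedBall_zero_iff.mp x.2)
  let F : ℤ → ℂ → ℂ := fun n => Function.extend Subtype.val (g n).1 0
  have key : ∀ n (x : closedBall (0 : ℂ) 1), F n x = (g n).1 x := fun n x =>
    Subtype.val_injective.extend_apply (g n).1 0 x
  refine ⟨F, fun n => DiffContOnCl.mk (g n).2 ?_, fun s hs => ⟨?_, fun n => ?_⟩⟩
  · rw [closure_ball _ (one_ne_zero (α := ℝ)), continuousOn_iff_continuous_domRestrict]
    exact (g n).1.continuous.congr fun x => (key n x).symm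
  · have h1 : Tendsto (fun n => (g n).1) atTop (𝓝 (1 : C(closedBall (0 : ℂ) 1, ℂ))) :=
      (continuous_subtype_val.tendsto _).comp hg
    have h2 := ((continuous_eval_const (F := C(closedBall (0 : ℂ) 1, ℂ)) ⟨s, hs⟩).tendsto _).comp h1
    exact h2.congr fun n => (key n ⟨s, hs⟩).symm
  · have h := congrArg (fun f : discAlgebra => f.1 ⟨s, hs⟩) (hrec n)
    have k := fun n => (key n ⟨s, hs⟩).symm
    simp only at k
    simp [k, s₀] at h
    linear_combination h

/-! ### Zeros of a function on the disc and on its boundary. -/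

/-- In Jensen's formula each zero `u` contributes `log (R / |u|) ≥ 0`, with multiplicity. -/
theorem log_norm_le_circleAverage {F : ℂ → ℂ} {R : ℝ} (hR : 0 < R)
    (hF : AnalyticOnNhd ℂ F (closedBall 0 R)) (h0 : F 0 ≠ 0) :
    Real.log ‖F 0‖ ≤ Real.circleAverage (fun z => Real.log ‖F z‖) 0 R := by
  have hF' : AnalyticOnNhd ℂ F (closedBall 0 |R|) := by rwa [abs_of_pos hR]
  have hz : (0 : ℂ) ∈ closedBall (0 : ℂ) |R| := by simp
  rw [MeromorphicOn.circleAverage_log_norm hR.ne' hF'.meromorphicOn,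
    (hF' 0 hz).meromorphicTrailingCoeffAt_of_ne_zero h0]
  have h1 : MeromorphicOn.divisor F (closedBall 0 |R|) 0 = 0 := by
    rw [MeromorphicOn.AnalyticOnNhd.divisor_apply hF' hz, (hF' 0 hz).analyticOrderAt_eq_zero.mpr h0]
    rfl
  have h2 : 0 ≤ ∑ᶠ u, (MeromorphicOn.divisor F (closedBall 0 |R|) u : ℝ)
      * Real.log (R * ‖0 - u‖⁻¹) := by
    refine finsum_nonneg fun u => ?_
    by_cases hu : u ∈ closedBall (0 : ℂ) |R|
    · refine mul_nonneg (by exact_mod_cast MeromorphicOn.AnalyticOnNhd.divisor_nonneg hF' u) ?_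
      -- For `u = 0` the logarithm is `log (R * 0⁻¹) = log 0 = 0` by convention.
      rcases eq_or_ne u 0 with rfl | hu0
      · simp
      · apply Real.log_nonneg
        rw [zero_sub, norm_neg, ← div_eq_mul_inv, one_le_div (norm_pos_iff.mpr hu0)]
        simpa [abs_of_pos hR] using hu
    · rw [Function.locallyFinsuppWithin.apply_eq_zero_of_notMem _ hu]
      simp
  rw [h1]
  simp only [Int.cast_zero, zero_mul, add_zero]
  linarith

theorem eventually_ne_zero_of_disc {F : ℂ → ℂ} (hF : DifferentiableOn ℂ F (ball 0 1))
    (h0 : F 0 ≠ 0) {s : ℂ} (hs : s ∈ ball (0 : ℂ) 1) : ∀ᶠ w in 𝓝[≠] s, F w ≠ 0 := by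
  have hA : AnalyticOnNhd ℂ F (ball 0 1) := hF.analyticOnNhd isOpen_ball
  refine (hA s hs).eventually_eq_zero_or_eventually_ne_zero.resolve_left fun h => h0 ?_
  exact hA.eqOn_zero_of_preconnected_of_eventuallyEq_zero (convex_ball 0 1).isPreconnected hs h
    (mem_ball_self one_pos)

theorem countable_zeros_disc {F : ℂ → ℂ} (hF : DifferentiableOn ℂ F (ball 0 1))
    (h0 : F 0 ≠ 0) : {s ∈ ball (0 : ℂ) 1 | F s = 0}.Countable := by
  have : DiscreteTopology {s ∈ ball (0 : ℂ) 1 | F s = 0} := by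
    rw [discreteTopology_subtype_iff]
    intro s hs
    rw [← disjoint_iff, disjoint_principal_right]
    filter_upwards [eventually_ne_zero_of_disc hF h0 hs.1] with w hw hw'
    exact hw hw'.2
  exact Set.countable_coe_iff.mp countable_of_Lindelof_of_discrete

/-- Jensen bounds the mean of `log ‖F‖` below on circles of radius `r < 1`. Truncating at `ε` allows
`r → 1` by dominated convergence. On the zero set the truncated logarithm is `log ε`, so positive
measure would violate the bound as `ε → 0`. -/
theorem volume_circle_zeros_eq_zero {F : ℂ → ℂ} (hF : DiffContOnCl ℂ F (ball 0 1)) (h0 : F 0 ≠ 0) :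
    volume {θ ∈ Set.Ioc 0 (2 * Real.pi) | F (circleMap 0 1 θ) = 0} = 0 := by
  have hcont := hF.continuousOn_ball
  obtain ⟨M, hM⟩ := (isCompact_closedBall (0 : ℂ) 1).exists_bound_of_continuousOn hcont
  set L : ℝ := Real.log (max M 1) with hL
  have hL0 : 0 ≤ L := Real.log_nonneg (le_max_right _ _)
  have hmem : ∀ r : ℝ, 0 ≤ r → r ≤ 1 → ∀ θ, circleMap 0 r θ ∈ closedBall (0 : ℂ) 1 := fun r h1 h2 θ => by
    simp [abs_of_nonneg h1, h2]
  let h : ℝ → ℝ → ℝ → ℝ := fun ε r θ => Real.log (max ‖F (circleMap 0 r θ)‖ ε)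
  have hh : ∀ ε : ℝ, 0 < ε → ε ≤ 1 → ∀ r : ℝ, 0 ≤ r → r ≤ 1 → ∀ θ,
      Real.log ε ≤ h ε r θ ∧ h ε r θ ≤ L := fun ε hε hε1 r h1 h2 θ => by
    refine ⟨Real.log_le_log hε (le_max_right _ _), Real.log_le_log (hε.trans_le (le_max_right _ _)) ?_⟩
    exact max_le_max (hM _ (hmem r h1 h2 θ)) hε1
  have hcr : ∀ r : ℝ, 0 ≤ r → r ≤ 1 → Continuous fun θ => F (circleMap 0 r θ) := fun r h1 h2 =>
    hcont.comp_continuous (continuous_circleMap 0 r) (hmem r h1 h2)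
  have hch : ∀ ε : ℝ, 0 < ε → ∀ r : ℝ, 0 ≤ r → r ≤ 1 → Continuous (h ε r) := fun ε hε r h1 h2 =>
    ((hcr r h1 h2).norm.max continuous_const).log fun θ => (hε.trans_le (le_max_right _ _)).ne'
  have hjensen : ∀ ε : ℝ, 0 < ε → ε ≤ 1 → ∀ r ∈ Set.Ioo (0 : ℝ) 1,
      2 * Real.pi * Real.log ‖F 0‖ ≤ ∫ θ in (0)..(2 * Real.pi), h ε r θ := fun ε hε hε1 r hr => by
    have hA : AnalyticOnNhd ℂ F (closedBall 0 r) :=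
      (hF.differentiableOn.analyticOnNhd isOpen_ball).mono (closedBall_subset_ball hr.2)
    have hJ := log_norm_le_circleAverage hr.1 hA h0
    rw [Real.circleAverage_def, smul_eq_mul, inv_mul_eq_div, le_div_iff₀ Real.two_pi_pos, mul_comm] at hJ
    refine hJ.trans (intervalIntegral.integral_mono_ae Real.two_pi_pos.le ?_
      ((hch ε hε r hr.1.le hr.2.le).intervalIntegrable _ _) ?_)
    · have := MeromorphicOn.circleIntegrable_log_norm (f := F) (c := 0) (R := r)
        ((hA.mono (by rw [abs_of_pos hr.1]; exact sphere_subset_closedBall)).meromorphicOn)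
      exact this
    -- As `Real.log 0 = 0` may exceed `log ε`, the pointwise comparison can fail at zeros; they are
    -- countable and are discarded.
    · have hc := ((countable_zeros_disc hF.differentiableOn h0).preimage_circleMap 0 hr.1.ne').measure_zero volume
      filter_upwards [measure_eq_zero_iff_ae_notMem.mp hc] with θ hθ
      have hne : F (circleMap 0 r θ) ≠ 0 := fun hz => hθ ⟨by simp [abs_of_pos hr.1, hr.2], hz⟩
      exact Real.log_le_log (norm_pos_iff.mpr hne) (le_max_left _ _)
  have hlim : ∀ ε : ℝ, 0 < ε → ε ≤ 1 →
      2 * Real.pi * Real.log ‖F 0‖ ≤ ∫ θ in (0)..(2 * Real.pi), h ε 1 θ := fun ε hε hε1 => by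
    have hev : ∀ᶠ r : ℝ in 𝓝[<] 1, r ∈ Set.Ioo (0 : ℝ) 1 := Ioo_mem_nhdsLT one_pos
    refine ge_of_tendsto (f := fun r => ∫ θ in (0)..(2 * Real.pi), h ε r θ) ?_ (hev.mono fun r hr => hjensen ε hε hε1 r hr)
    refine intervalIntegral.tendsto_integral_filter_of_dominated_convergence
      (fun _ => L + |Real.log ε|) ?_ ?_ (by simp) ?_
    · exact hev.mono fun r hr => (hch ε hε r hr.1.le hr.2.le).aestronglyMeasurable
    · refine hev.mono fun r hr => Eventually.of_forall fun θ _ => ?_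
      obtain ⟨h1, h2⟩ := hh ε hε hε1 r hr.1.le hr.2.le θ
      rw [Real.norm_eq_abs, abs_le]
      constructor <;> linarith [neg_abs_le (Real.log ε), abs_nonneg (Real.log ε)]
    · refine Eventually.of_forall fun θ _ => ?_
      -- The limit is taken within the closed disc, since `F` is continuous only there.
      have h1 : Tendsto (fun r : ℝ => circleMap 0 r θ) (𝓝[<] 1) (𝓝[closedBall 0 1] circleMap 0 1 θ) := by
        refine tendsto_nhdsWithin_iff.mpr ⟨?_, hev.mono fun r hr => hmem r hr.1.le hr.2.le θ⟩
        have : Continuous fun r : ℝ => circleMap 0 r θ := by unfold circleMap; fun_prop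
        exact (this.tendsto 1).mono_left nhdsWithin_le_nhds
      have h2 := (hcont _ (hmem 1 zero_le_one le_rfl θ)).tendsto.comp h1
      exact (h2.norm.max tendsto_const_nhds).log (hε.trans_le (le_max_right _ _)).ne'
  set Z := {θ ∈ Set.Ioc 0 (2 * Real.pi) | F (circleMap 0 1 θ) = 0} with hZ
  have hZm : MeasurableSet Z :=
    measurableSet_Ioc.inter ((isClosed_singleton.preimage (hcr 1 zero_le_one le_rfl)).measurableSet)
  have hfin : volume Z ≠ ⊤ := ((measure_mono (fun θ hθ => hθ.1)).trans_lt measure_Ioc_lt_top).ne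
  have hmain : ∀ ε : ℝ, 0 < ε → ε ≤ 1 →
      (L - Real.log ε) * volume.real Z ≤ 2 * Real.pi * L - 2 * Real.pi * Real.log ‖F 0‖ := by
    intro ε hε hε1
    have hc := hch ε hε 1 zero_le_one le_rfl
    have hb := hh ε hε hε1 1 zero_le_one le_rfl
    have hint : ∫ θ in Set.Ioc 0 (2 * Real.pi), (L - h ε 1 θ) =
        2 * Real.pi * L - ∫ θ in (0)..(2 * Real.pi), h ε 1 θ := by
      rw [← intervalIntegral.integral_of_le Real.two_pi_pos.le, intervalIntegral.integral_sub
        (by simp) (hc.intervalIntegrable _ _)]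
      simp
    have hI : IntegrableOn (fun θ => L - h ε 1 θ) (Set.Ioc 0 (2 * Real.pi)) :=
      ((continuous_const.sub hc).intervalIntegrable 0 (2 * Real.pi)).1
    have h3 : ∫ θ in Z, (L - h ε 1 θ) ≤ ∫ θ in Set.Ioc 0 (2 * Real.pi), (L - h ε 1 θ) :=
      setIntegral_mono_set hI (Eventually.of_forall fun θ => sub_nonneg.mpr (hb θ).2)
        (Eventually.of_forall fun θ hθ => hθ.1)
    have h4 : ∫ θ in Z, (L - h ε 1 θ) = ∫ θ in Z, (L - Real.log ε) := by
      refine setIntegral_congr_fun hZm fun θ hθ => ?_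
      simp [h, hθ.2, hε.le]
    rw [h4, setIntegral_const, smul_eq_mul, hint] at h3
    linarith [hlim ε hε hε1]
  by_contra hne
  have hpos : 0 < volume.real Z := ENNReal.toReal_pos hne hfin
  have ht : Tendsto (fun ε => (L - Real.log ε) * volume.real Z) (𝓝[>] 0) atTop :=
    (tendsto_atTop_add_const_left _ L (tendsto_neg_atBot_atTop.comp Real.tendsto_log_nhdsGT_zero)).atTop_mul_const hpos
  obtain ⟨ε, h1, h2⟩ := ((ht.eventually_gt_atTop _).and (Ioc_mem_nhdsGT (zero_lt_one (α := ℝ)))).exists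
  exact (hmain ε h2.1 h2.2).not_gt h1

/-! ### Solutions of the recurrence and their Wronskians. -/

theorem isSolution_iff {a p q : ℤ → ℂ} {lam : ℂ} {y : ℤ → ℂ} : IsSolution a p q lam y ↔
    ∀ n, a n * y (n + 1) + a (n - 1) * y (n - 1)
      + (q n + 2 * lam * p n + lam ^ 2 - a n - a (n - 1)) * y n = 0 := by
  refine forall_congr' fun n => ?_
  simp only [pencil, fwdDiff, add_sub_cancel_right, sub_add_cancel]
  constructor <;> intro h <;> linear_combination h

theorem wronskian_eq {a p q : ℤ → ℂ} {lam : ℂ} {u v : ℤ → ℂ} (hu : IsSolution a p q lam u)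
    (hv : IsSolution a p q lam v) (n m : ℤ) : wronskian a u v n = wronskian a u v m := by
  rw [isSolution_iff] at hu hv
  have hper : Function.Periodic (wronskian a u v) 1 := fun n => by
    have h1 := hu (n + 1)
    have h2 := hv (n + 1)
    simp only [wronskian, add_sub_cancel_right] at h1 h2 ⊢
    linear_combination u (n + 1) * h2 - v (n + 1) * h1
  have h0 : ∀ k : ℤ, wronskian a u v k = wronskian a u v 0 := fun k => by
    simpa using hper.int_mul k 0
  rw [h0 n, h0 m]

theorem wronskian_eq_zero_of_tendsto {a p q : ℤ → ℂ} {lam : ℂ} {u v : ℤ → ℂ}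
    (hu : IsSolution a p q lam u) (hv : IsSolution a p q lam v) {l : Filter ℤ} [l.NeBot]
    (h : Tendsto (wronskian a u v) l (𝓝 0)) (n : ℤ) : wronskian a u v n = 0 :=
  tendsto_nhds_unique (tendsto_const_nhds.congr fun m => wronskian_eq hu hv n m) h

theorem IsSolution.eq_zero {a p q : ℤ → ℂ} (ha : ∀ n, a n ≠ 0) {lam : ℂ} {y : ℤ → ℂ}
    (hy : IsSolution a p q lam y) {N : ℤ} (h0 : y N = 0) (h1 : y (N + 1) = 0) (n : ℤ) : y n = 0 := by
  rw [isSolution_iff] at hy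
  suffices h : y n = 0 ∧ y (n + 1) = 0 from h.1
  induction n using Int.inductionOn' (b := N) with
  | zero => exact ⟨h0, h1⟩
  | succ k _ ih =>
    have := hy (k + 1)
    rw [add_sub_cancel_right, ih.1, ih.2, mul_zero, mul_zero, add_zero, add_zero] at this
    exact ⟨ih.2, (mul_eq_zero.mp this).resolve_left (ha _)⟩
  | pred k _ ih =>
    have := hy k
    rw [ih.1, ih.2, mul_zero, mul_zero, add_zero, zero_add] at this
    exact ⟨(mul_eq_zero.mp this).resolve_left (ha _), by simpa using ih.1⟩

theorem IsSolution.eq_mul {a p q : ℤ → ℂ} (ha : ∀ n, a n ≠ 0) {lam : ℂ} {y v : ℤ → ℂ}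
    (hy : IsSolution a p q lam y) (hv : IsSolution a p q lam v) {N : ℤ} (hN : v N ≠ 0)
    (hW : wronskian a y v N = 0) (n : ℤ) : y n = y N / v N * v n := by
  have hd : IsSolution a p q lam fun n => y n - y N / v N * v n := by
    rw [isSolution_iff] at hy hv ⊢
    intro n
    linear_combination hy n - y N / v N * hv n
  refine sub_eq_zero.mp (hd.eq_zero ha (N := N) (by field_simp; ring) ?_ n)
  have := (mul_eq_zero.mp hW).resolve_left (ha _)
  field_simp
  linear_combination -this

/-- Transfers results at `+∞` to `-∞`. The shift in `a` arises because `a n` couples the sites `n`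
and `n + 1`. -/
theorem IsSolution.reflect {a p q : ℤ → ℂ} {lam : ℂ} {y : ℤ → ℂ} (hy : IsSolution a p q lam y) :
    IsSolution (fun n => a (-n - 1)) (fun n => p (-n)) (fun n => q (-n)) lam fun n => y (-n) := by
  rw [isSolution_iff] at hy ⊢
  intro n
  have := hy (-n)
  simp only [show -(n + 1) = -n - 1 by ring, show -(n - 1) = -n + 1 by ring,
    add_sub_cancel_right]
  linear_combination this

/-! ### Uniqueness and growth of Jost solutions. -/

theorem neg_one_zpow_mul_exp (z : ℂ) (n : ℤ) :
    (-1 : ℂ) ^ n * Complex.exp (Complex.I * n * z) = (-Complex.exp (Complex.I * z)) ^ n := by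
  rw [neg_eq_neg_one_mul (Complex.exp _), mul_zpow, ← Complex.exp_int_mul]
  congr 2; ring

theorem neg_one_zpow_mul_exp_neg (z : ℂ) (n : ℤ) :
    (-1 : ℂ) ^ n * Complex.exp (-(Complex.I * n * z)) = ((-Complex.exp (Complex.I * z)) ^ n)⁻¹ := by
  rw [← neg_one_zpow_mul_exp, mul_inv, ← Complex.exp_neg, ← inv_zpow, inv_neg_one]

theorem isJostPlus_iff {a p q : ℤ → ℂ} {z : ℂ} {f : ℤ → ℂ} : IsJostPlus a p q z f ↔
    IsSolution a p q (2 * Complex.cos (z / 2)) f ∧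
      Tendsto (fun n : ℤ => ((-Complex.exp (Complex.I * z)) ^ n)⁻¹ * f n) atTop (𝓝 1) := by
  simp only [IsJostPlus, neg_one_zpow_mul_exp_neg]

theorem isJostMinus_iff {a p q : ℤ → ℂ} {z : ℂ} {f : ℤ → ℂ} : IsJostMinus a p q z f ↔
    IsJostPlus (fun n => a (-n - 1)) (fun n => p (-n)) (fun n => q (-n)) z fun n => f (-n) := by
  have hS : IsSolution a p q (2 * Complex.cos (z / 2)) f ↔ IsSolution (fun n => a (-n - 1))
      (fun n => p (-n)) (fun n => q (-n)) (2 * Complex.cos (z / 2)) fun n => f (-n) :=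
    ⟨fun h => h.reflect, fun h => by simpa using h.reflect⟩
  rw [isJostPlus_iff, IsJostMinus, hS]
  refine and_congr_right fun _ => ?_
  simp only [neg_one_zpow_mul_exp]
  rw [← tendsto_comp_neg_atTop_iff]
  simp [zpow_neg]

theorem tendsto_coeff_atTop {a p q : ℤ → ℂ}
    (hsum : Summable fun n : ℕ => (n : ℝ) * (‖1 - a n‖ + ‖p n‖ + ‖q n‖)) :
    Tendsto a atTop (𝓝 1) := by
  have h1 : Tendsto (fun n : ℕ => a n) atTop (𝓝 1) := by
    rw [tendsto_iff_norm_sub_tendsto_zero]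
    refine squeeze_zero' (Eventually.of_forall fun n => norm_nonneg _) ?_ hsum.tendsto_atTop_zero
    filter_upwards [eventually_ge_atTop 1] with n hn
    have : (1 : ℝ) ≤ n := by exact_mod_cast hn
    rw [norm_sub_rev]
    nlinarith [norm_nonneg (1 - a n), norm_nonneg (p n), norm_nonneg (q n),
      mul_nonneg (sub_nonneg.mpr this) (norm_nonneg (1 - a n)),
      mul_nonneg (Nat.cast_nonneg (α := ℝ) n) (norm_nonneg (p n)),
      mul_nonneg (Nat.cast_nonneg (α := ℝ) n) (norm_nonneg (q n))]
  have htn : Tendsto Int.toNat atTop atTop := tendsto_atTop.mpr fun b => by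
    filter_upwards [eventually_ge_atTop (b : ℤ)] with n hn
    omega
  refine (h1.comp htn).congr' ?_
  filter_upwards [eventually_ge_atTop 0] with n hn
  simp [hn]

theorem norm_exp_I_mul_le_one {z : ℂ} (hz : 0 ≤ z.im) : ‖-Complex.exp (Complex.I * z)‖ ≤ 1 := by
  simpa [Complex.norm_exp] using hz

theorem IsJostPlus.eventually_norm_le {a p q : ℤ → ℂ} {z : ℂ} (hz : 0 ≤ z.im) {f : ℤ → ℂ}
    (hf : IsJostPlus a p q z f) : ∀ᶠ n in atTop, ‖f n‖ ≤ 2 := by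
  have h := (isJostPlus_iff.mp hf).2.norm
  rw [norm_one] at h
  filter_upwards [h.eventually (ge_mem_nhds one_lt_two), eventually_ge_atTop 0] with n hn h0
  rw [norm_mul, norm_inv, norm_zpow, inv_mul_eq_div] at hn
  lift n to ℕ using h0
  have hc : (-Complex.exp (Complex.I * z)) ≠ 0 := neg_ne_zero.mpr (Complex.exp_ne_zero _)
  rw [zpow_natCast, div_le_iff₀ (pow_pos (norm_pos_iff.mpr hc) _)] at hn
  linarith [pow_le_one₀ (n := n) (norm_nonneg _) (norm_exp_I_mul_le_one hz)]

theorem IsJostPlus.eventually_ne_zero {a p q : ℤ → ℂ} {z : ℂ} {f : ℤ → ℂ}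
    (hf : IsJostPlus a p q z f) : ∀ᶠ n in atTop, f n ≠ 0 := by
  filter_upwards [(isJostPlus_iff.mp hf).2.eventually_ne one_ne_zero] with n hn h
  simp [h] at hn

/-- The Wronskian is `c^(2n+1)` times a quantity tending to `0`, and `‖c‖ ≤ 1`; so it vanishes, the
solutions are proportional, and the normalisation makes the factor `1`. -/
theorem IsJostPlus.unique {a p q : ℤ → ℂ} (ha : ∀ n, a n ≠ 0)
    (hlim : Tendsto a atTop (𝓝 1)) {z : ℂ} (hz : 0 ≤ z.im) {f g : ℤ → ℂ}
    (hf : IsJostPlus a p q z f) (hg : IsJostPlus a p q z g) : f = g := by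
  set c := -Complex.exp (Complex.I * z) with hc
  have hc0 : c ≠ 0 := neg_ne_zero.mpr (Complex.exp_ne_zero _)
  have hf' := (isJostPlus_iff.mp hf).2
  have hg' := (isJostPlus_iff.mp hg).2
  rw [← hc] at hf' hg'
  have hs1 : Tendsto (fun n : ℤ => n + 1) atTop atTop := tendsto_atTop_add_const_right _ _ tendsto_id
  have hW : Tendsto (wronskian a f g) atTop (𝓝 0) := by
    have h1 := (hf'.mul (hg'.comp hs1)).sub ((hf'.comp hs1).mul hg')
    rw [sub_self] at h1
    have h2 := (hlim.mul h1).norm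
    rw [mul_zero, norm_zero] at h2
    refine squeeze_zero_norm' ?_ h2
    filter_upwards [eventually_ge_atTop 0] with n hn
    lift n to ℕ using hn
    have hW : wronskian a f g n = c ^ (2 * n + 1) * (a n * ((c ^ (n : ℤ))⁻¹ * f n *
        ((c ^ ((n : ℤ) + 1))⁻¹ * g (n + 1)) - (c ^ ((n : ℤ) + 1))⁻¹ * f (n + 1) *
          ((c ^ (n : ℤ))⁻¹ * g n))) := by
      rw [wronskian, zpow_add_one₀ hc0, zpow_natCast]
      field_simp
      ring
    rw [hW, norm_mul, norm_pow]
    exact mul_le_of_le_one_left (norm_nonneg _) (pow_le_one₀ (norm_nonneg _) (norm_exp_I_mul_le_one hz))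
  obtain ⟨N, hN⟩ := hg.eventually_ne_zero.exists
  have hfg := IsSolution.eq_mul ha hf.1 hg.1 hN (wronskian_eq_zero_of_tendsto hf.1 hg.1 hW N)
  have hone : f N / g N = 1 := by
    refine tendsto_nhds_unique ?_ hf'
    have := hg'.const_mul (f N / g N)
    rw [mul_one] at this
    refine this.congr fun n => ?_
    rw [hfg n]
    ring
  funext n
  rw [hfg n, hone, one_mul]

/-- A solution that tends to zero at `+∞` is a multiple of the Jost solution. -/
theorem IsSolution.eq_mul_jost {a p q : ℤ → ℂ} (ha : ∀ n, a n ≠ 0)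
    (hlim : Tendsto a atTop (𝓝 1)) {z : ℂ} (hz : 0 ≤ z.im) {y f : ℤ → ℂ}
    (hy : IsSolution a p q (2 * Complex.cos (z / 2)) y) (hy0 : Tendsto y atTop (𝓝 0))
    (hf : IsJostPlus a p q z f) : ∃ C : ℂ, ∀ n, y n = C * f n := by
  have hs1 : Tendsto (fun n : ℤ => n + 1) atTop atTop := tendsto_atTop_add_const_right _ _ tendsto_id
  have hb := hf.eventually_norm_le hz
  have hW : Tendsto (wronskian a y f) atTop (𝓝 0) := by
    have h1 : Tendsto (fun n => y n * f (n + 1)) atTop (𝓝 0) :=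
      hy0.zero_mul_isBoundedUnder_le ⟨2, eventually_map.mpr (hs1.eventually hb)⟩
    have h2 : Tendsto (fun n => y (n + 1) * f n) atTop (𝓝 0) :=
      (hy0.comp hs1).zero_mul_isBoundedUnder_le ⟨2, eventually_map.mpr hb⟩
    have h3 := hlim.mul (h1.sub h2)
    rwa [sub_zero, mul_zero] at h3
  obtain ⟨N, hN⟩ := hf.eventually_ne_zero.exists
  exact ⟨_, IsSolution.eq_mul ha hy hf.1 hN (wronskian_eq_zero_of_tendsto hy hf.1 hW N)⟩

theorem IsJostPlus.not_tendsto_zero {a p q : ℤ → ℂ} {z : ℂ} (hz : z.im = 0) {f : ℤ → ℂ}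
    (hf : IsJostPlus a p q z f) : ¬ Tendsto f atTop (𝓝 0) := fun h => by
  have h1 := (isJostPlus_iff.mp hf).2.norm
  have hc : ‖-Complex.exp (Complex.I * z)‖ = 1 := by simp [Complex.norm_exp, hz]
  simp only [norm_mul, norm_inv, norm_zpow, hc, one_zpow, inv_one, one_mul, norm_one] at h1
  exact one_ne_zero (tendsto_nhds_unique h1 (by simpa using h.norm))

/-! ### The Wronskian as a function on the disc. -/

theorem two_mul_cos_half (z : ℂ) : 2 * Complex.cos (z / 2) =
    Complex.exp (Complex.I * z / 2) + (Complex.exp (Complex.I * z / 2))⁻¹ := by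
  rw [Complex.two_cos, ← Complex.exp_neg]
  congr 2 <;> ring

theorem exp_half_sq (z : ℂ) :
    Complex.exp (Complex.I * z / 2) ^ 2 = Complex.exp (Complex.I * z) := by
  rw [← Complex.exp_nat_mul]
  congr 1
  push_cast; ring

theorem exp_half_mem_closedBall {z : ℂ} (hz : 0 ≤ z.im) :
    Complex.exp (Complex.I * z / 2) ∈ closedBall (0 : ℂ) 1 := by
  simp [Complex.norm_exp]
  linarith

theorem exp_half_mem_ball {z : ℂ} (hz : 0 < z.im) :
    Complex.exp (Complex.I * z / 2) ∈ ball (0 : ℂ) 1 := by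
  simp [Complex.norm_exp]
  linarith

theorem exists_jostPlus_family (a p q : ℤ → ℂ) (ha : ∀ n, a n ≠ 0)
    (hsum : Summable fun n : ℕ => (n : ℝ) * (‖1 - a n‖ + ‖p n‖ + ‖q n‖)) :
    ∃ g : ℤ → ℂ → ℂ, (∀ n, DiffContOnCl ℂ (g n) (ball 0 1)) ∧ (∀ n, g n 0 ≠ 0) ∧
      ∀ z : ℂ, 0 ≤ z.im → IsJostPlus a p q z fun n =>
        (-Complex.exp (Complex.I * z)) ^ n * g n (Complex.exp (Complex.I * z / 2)) := by
  obtain ⟨g, hg, hrec⟩ := exists_reduced_jost_on_disc a p q ha hsum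
  refine ⟨g, hg, fun n => ?_, fun z hz => isJostPlus_iff.mpr ⟨?_, ?_⟩⟩
  -- At `s = 0` the recurrence is `a (n-1) * g (n-1) = g n`, so nonvanishing near `+∞` propagates
  -- down to every index.
  · obtain ⟨hlim, h0⟩ := hrec 0 (by simp)
    obtain ⟨N, hN, hnN⟩ := ((hlim.eventually_ne one_ne_zero).and (eventually_ge_atTop n)).exists
    induction n, hnN using Int.leInductionDown with
    | base => exact hN
    | pred k _ ih =>
      intro h
      have := h0 k
      simp [h] at this
      exact ih this.symm
  · obtain ⟨-, h⟩ := hrec _ (exp_half_mem_closedBall hz)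
    rw [two_mul_cos_half, isSolution_iff, ← exp_half_sq]
    set s := Complex.exp (Complex.I * z / 2)
    have hs : s ≠ 0 := Complex.exp_ne_zero _
    intro n
    have hc : -s ^ 2 ≠ 0 := neg_ne_zero.mpr (pow_ne_zero _ hs)
    rw [zpow_add_one₀ hc, zpow_sub_one₀ hc, inv_neg]
    have hn := h n
    field_simp
    linear_combination -(-s ^ 2) ^ n * hn
  · have hc : -Complex.exp (Complex.I * z) ≠ 0 := neg_ne_zero.mpr (Complex.exp_ne_zero _)
    refine (hrec _ (exp_half_mem_closedBall hz)).1.congr fun n => ?_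
    rw [inv_mul_cancel_left₀ (zpow_ne_zero _ hc)]

theorem summable_atTop_half {a p q : ℤ → ℂ}
    (hsum : Summable fun n : ℤ => |(n : ℝ)| * (‖1 - a n‖ + ‖p n‖ + ‖q n‖)) :
    Summable fun n : ℕ => (n : ℝ) * (‖1 - a n‖ + ‖p n‖ + ‖q n‖) := by
  simpa [Function.comp_def] using hsum.comp_injective (Nat.cast_injective (R := ℤ))

theorem summable_reflect {a p q : ℤ → ℂ}
    (hsum : Summable fun n : ℤ => |(n : ℝ)| * (‖1 - a n‖ + ‖p n‖ + ‖q n‖)) :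
    Summable fun n : ℕ => (n : ℝ) * (‖1 - a (-(n : ℤ) - 1)‖ + ‖p (-(n : ℤ))‖ + ‖q (-(n : ℤ))‖) := by
  have h1 := hsum.comp_injective (i := fun n : ℕ => -(n : ℤ) - 1) fun m n h => by simpa using h
  have h2 := hsum.comp_injective (i := fun n : ℕ => -(n : ℤ)) fun m n h => by simpa using h
  refine Summable.of_nonneg_of_le (fun n => by positivity) (fun n => ?_) (h1.add h2)
  have hn : |((-(n : ℤ) - 1 : ℤ) : ℝ)| = n + 1 := by
    push_cast
    rw [abs_of_neg (by linarith [Nat.cast_nonneg (α := ℝ) n])]; ring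
  have hn' : |((-(n : ℤ) : ℤ) : ℝ)| = n := by simp
  simp only [Function.comp_apply, hn, hn']
  have h0 := Nat.cast_nonneg (α := ℝ) n
  have := norm_nonneg (1 - a (-(n : ℤ) - 1))
  have := norm_nonneg (p (-(n : ℤ) - 1))
  have := norm_nonneg (q (-(n : ℤ) - 1))
  have := mul_nonneg h0 (norm_nonneg (p (-(n : ℤ) - 1)))
  have := mul_nonneg h0 (norm_nonneg (q (-(n : ℤ) - 1)))
  have := mul_nonneg h0 (norm_nonneg (1 - a (-(n : ℤ))))
  linarith

/-- Up to the factor `exp (I z)`, the Wronskian `Φ` is a function of `s = exp (I z / 2)` that is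
holomorphic in the unit disc, continuous up to the boundary and nonzero at the origin. -/
theorem exists_disc_function (a p q : ℤ → ℂ) (ha : ∀ n, a n ≠ 0)
    (hsum : Summable fun n : ℤ => |(n : ℝ)| * (‖1 - a n‖ + ‖p n‖ + ‖q n‖)) :
    (∀ z : ℂ, 0 ≤ z.im → IsJostPlus a p q z (jostPlus a p q z) ∧
      IsJostMinus a p q z (jostMinus a p q z)) ∧
    ∃ G : ℂ → ℂ, DiffContOnCl ℂ G (ball 0 1) ∧ G 0 ≠ 0 ∧
      ∀ z : ℂ, 0 ≤ z.im → (Phi a p q z = 0 ↔ G (Complex.exp (Complex.I * z / 2)) = 0) := by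
  obtain ⟨g, hg, hg0, hgJ⟩ := exists_jostPlus_family a p q ha (summable_atTop_half hsum)
  obtain ⟨h, hh, hh0, hhJ⟩ := exists_jostPlus_family (fun n => a (-n - 1)) (fun n => p (-n))
    (fun n => q (-n)) (fun n => ha _) (summable_reflect hsum)
  have hlim := tendsto_coeff_atTop (summable_atTop_half hsum)
  have hlim' := tendsto_coeff_atTop (a := fun n => a (-n - 1)) (p := fun n => p (-n))
    (q := fun n => q (-n)) (summable_reflect hsum)
  have hplus : ∀ z : ℂ, 0 ≤ z.im → IsJostPlus a p q z (jostPlus a p q z) := fun z hz => by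
    have hex : ∃ f, IsJostPlus a p q z f := ⟨_, hgJ z hz⟩
    rw [jostPlus, dif_pos hex]
    exact hex.choose_spec
  have hminus : ∀ z : ℂ, 0 ≤ z.im → IsJostMinus a p q z (jostMinus a p q z) := fun z hz => by
    have hex : ∃ f, IsJostMinus a p q z f :=
      ⟨fun n => (-Complex.exp (Complex.I * z)) ^ (-n) * h (-n) (Complex.exp (Complex.I * z / 2)),
        isJostMinus_iff.mpr (by simpa using hhJ z hz)⟩
    rw [jostMinus, dif_pos hex]
    exact hex.choose_spec
  -- This is `s² Φ` with the negative powers of `s` cleared; at `s = 0` only `a 0 * h (-1) 0 * g 0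
  -- 0` remains.
  refine ⟨fun z hz => ⟨hplus z hz, hminus z hz⟩,
    fun s => a 0 * (h (-1) s * g 0 s - s ^ 4 * (h 0 s * g 1 s)), ?_, ?_, fun z hz => ?_⟩
  · have hp : DiffContOnCl ℂ (fun s : ℂ => s ^ 4) (ball 0 1) :=
      (differentiable_id.pow 4).diffContOnCl
    exact (((hh (-1)).smul (hg 0)).sub (hp.smul ((hh 0).smul (hg 1)))).const_smul (a 0)
  · simpa using ⟨ha 0, hh0 _, hg0 _⟩
  -- `jostPlus` and `jostMinus` are arbitrary choices; uniqueness identifies them with the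
  -- holomorphic families.
  · have e1 : jostPlus a p q z = _ :=
      IsJostPlus.unique ha hlim hz (hplus z hz) (hgJ z hz)
    have e2 := IsJostPlus.unique (fun n => ha _) hlim' hz (isJostMinus_iff.mp (hminus z hz)) (hhJ z hz)
    have e3 := fun n => congrFun e2 (-n)
    simp only [neg_neg] at e3
    simp only [Phi, wronskian, e1, e3, ← exp_half_sq]
    set s := Complex.exp (Complex.I * z / 2)
    have hs : s ≠ 0 := Complex.exp_ne_zero _
    have hk : s ^ 2 * (a 0 * ((-s ^ 2) ^ (-0 : ℤ) * h (-0) s * ((-s ^ 2) ^ (0 + 1 : ℤ) * g (0 + 1) s)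
        - (-s ^ 2) ^ (-(0 + 1) : ℤ) * h (-(0 + 1)) s * ((-s ^ 2) ^ (0 : ℤ) * g 0 s))) =
        a 0 * (h (-1) s * g 0 s - s ^ 4 * (h 0 s * g 1 s)) := by
      simp only [neg_zero, zpow_zero, zero_add, zpow_one, zpow_neg]
      field_simp
      ring
    change _ ↔ a 0 * (h (-1) s * g 0 s - s ^ 4 * (h 0 s * g 1 s)) = 0
    rw [← hk]
    exact ⟨fun h => by rw [h, mul_zero],
      fun h => (mul_eq_zero.mp h).resolve_left (pow_ne_zero 2 hs)⟩

/-! ### Eigenvalues. -/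

theorem exists_two_mul_cos_half_eq (lam : ℂ) : ∃ z : ℂ, 0 ≤ z.im ∧ lam = 2 * Complex.cos (z / 2) := by
  obtain ⟨z, hz⟩ := Complex.cos_surjective (lam / 2)
  rcases le_total 0 z.im with h | h
  · refine ⟨2 * z, by simpa using h, ?_⟩
    rw [mul_div_cancel_left₀ _ two_ne_zero, hz]; ring
  · refine ⟨-(2 * z), by simp; linarith, ?_⟩
    rw [neg_div, mul_div_cancel_left₀ _ two_ne_zero, Complex.cos_neg, hz]; ring

theorem tendsto_cofinite_zero_of_lp (y : lp (fun _ : ℤ => ℂ) 2) :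
    Tendsto (fun n => y n) cofinite (𝓝 0) := by
  have h := (lp.memℓp y).summable (by norm_num)
  have h2 := h.tendsto_cofinite_zero
  rw [tendsto_zero_iff_norm_tendsto_zero]
  have h3 := h2.sqrt
  simpa [Real.sqrt_sq] using h3

theorem exists_zero_of_mem_eigenvalues {a p q : ℤ → ℂ} (ha : ∀ n, a n ≠ 0)
    (hsum : Summable fun n : ℤ => |(n : ℝ)| * (‖1 - a n‖ + ‖p n‖ + ‖q n‖)) {lam : ℂ}
    (h : lam ∈ eigenvalues a p q) :
    ∃ z : ℂ, 0 < z.im ∧ lam = 2 * Complex.cos (z / 2) ∧ Phi a p q z = 0 := by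
  obtain ⟨y, hy0, hy⟩ := h
  obtain ⟨z, hz, rfl⟩ := exists_two_mul_cos_half_eq lam
  obtain ⟨hJ, -⟩ := exists_disc_function a p q ha hsum
  obtain ⟨hp, hm⟩ := hJ z hz
  rw [isJostMinus_iff] at hm
  have hlim := tendsto_coeff_atTop (summable_atTop_half hsum)
  have hlim' := tendsto_coeff_atTop (a := fun n => a (-n - 1)) (p := fun n => p (-n))
    (q := fun n => q (-n)) (summable_reflect hsum)
  have hdec := tendsto_cofinite_zero_of_lp y
  have hdp : Tendsto (fun n => y n) atTop (𝓝 0) := hdec.mono_left atTop_le_cofinite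
  have hdm : Tendsto (fun n => y (-n)) atTop (𝓝 0) :=
    (hdec.mono_left atBot_le_cofinite).comp tendsto_neg_atTop_atBot
  obtain ⟨C, hC⟩ := IsSolution.eq_mul_jost ha hlim hz hy hdp hp
  obtain ⟨D, hD⟩ := IsSolution.eq_mul_jost (fun n => ha _) hlim' hz hy.reflect hdm hm
  have hyne : ¬ ∀ n, y n = 0 := fun h => hy0 (by ext n; simpa using h n)
  have hC0 : C ≠ 0 := by rintro rfl; exact hyne fun n => by simpa using hC n
  have hD0 : D ≠ 0 := by rintro rfl; exact hyne fun n => by simpa using hD (-n)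
  have hD' : ∀ n, y n = D * jostMinus a p q z n := fun n => by simpa using hD (-n)
  -- For real `z` the Jost solution has modulus tending to `1`, so no nonzero multiple of it decays.
  refine ⟨z, hz.lt_of_ne' fun h0 => ?_, rfl, ?_⟩
  · refine hp.not_tendsto_zero h0 ?_
    have := hdp.const_mul C⁻¹
    rw [mul_zero] at this
    exact this.congr fun n => by rw [hC, inv_mul_cancel_left₀ hC0]
  · have key : ∀ n, jostMinus a p q z n = D⁻¹ * (C * jostPlus a p q z n) := fun n => by
      rw [← hC, hD', inv_mul_cancel_left₀ hD0]
    rw [Phi, wronskian, key, key]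
    ring

/-- `G` has no zeros near `0`, which bounds `s⁻¹`. On the punctured disc `s ↦ s + s⁻¹` is injective
with nonzero derivative, so isolated zeros give isolated values there. -/
theorem isBounded_countable_derivedSet {S : Set ℂ} {G : ℂ → ℂ} (hG : DiffContOnCl ℂ G (ball 0 1))
    (h0 : G 0 ≠ 0)
    (hS : ∀ lam ∈ S, ∃ s ∈ ball (0 : ℂ) 1, s ≠ 0 ∧ lam = s + s⁻¹ ∧ G s = 0) :
    Bornology.IsBounded S ∧ S.Countable ∧
      derivedSet S ⊆ {lam | ¬ ∃ s ∈ ball (0 : ℂ) 1, s ≠ 0 ∧ lam = s + s⁻¹} := by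
  refine ⟨?_, ?_, ?_⟩
  · have hc : ContinuousAt G 0 :=
      (hG.differentiableOn.differentiableAt (ball_mem_nhds 0 one_pos)).continuousAt
    obtain ⟨δ, hδ, hδG⟩ := Metric.eventually_nhds_iff.mp (hc.eventually_ne h0)
    refine isBounded_iff_forall_norm_le.mpr ⟨1 + δ⁻¹, fun lam hlam => ?_⟩
    obtain ⟨s, hs, hs0, rfl, hGs⟩ := hS lam hlam
    have hδs : δ ≤ ‖s‖ := by
      by_contra hlt
      exact hδG (by simpa using hlt) hGs
    refine (norm_add_le _ _).trans (add_le_add (mem_ball_zero_iff.mp hs).le ?_)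
    rw [norm_inv]
    exact inv_anti₀ hδ hδs
  · refine ((countable_zeros_disc hG.differentiableOn h0).image fun s => s + s⁻¹).mono ?_
    intro lam hlam
    obtain ⟨s, hs, -, rfl, hGs⟩ := hS lam hlam
    exact ⟨s, ⟨hs, hGs⟩, rfl⟩
  · rintro lam hlam ⟨s, hs, hs0, rfl⟩
    have hs1 : ‖s‖ < 1 := by simpa using hs
    have hd : HasStrictDerivAt (fun w : ℂ => w + w⁻¹) (1 + -(s ^ 2)⁻¹) s :=
      (hasStrictDerivAt_id s).add (hasStrictDerivAt_inv hs0)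
    have hd0 : (1 : ℂ) + -(s ^ 2)⁻¹ ≠ 0 := fun h => by
      have h1 : s ^ 2 = 1 := by
        field_simp at h
        linear_combination h
      have h2 := congrArg norm h1
      rw [norm_pow, norm_one] at h2
      nlinarith [norm_nonneg s]
    have hmap := hd.map_nhds_eq hd0
    have hev : ∀ᶠ w in 𝓝 s, w ≠ s → w ∈ ball (0 : ℂ) 1 ∧ w ≠ 0 ∧ G w ≠ 0 := by
      filter_upwards [eventually_nhdsWithin_iff.mp (eventually_ne_zero_of_disc hG.differentiableOn h0 hs),
        isOpen_ball.mem_nhds hs, eventually_ne_nhds hs0] with w h1 h2 h3 hw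
      exact ⟨h2, h3, h1 hw⟩
    have hev' : ∀ᶠ mu in 𝓝 (s + s⁻¹), mu ≠ s + s⁻¹ → mu ∉ S := by
      rw [← hmap, eventually_map]
      filter_upwards [hev] with w hw hne hmem
      have hws : w ≠ s := fun h => hne (by rw [h])
      obtain ⟨hwb, hw0, hGw⟩ := hw hws
      obtain ⟨t, ht, ht0, hwt, hGt⟩ := hS _ hmem
      -- The other preimage `w⁻¹` lies outside the disc, which forces `t = w`.
      have hprod : (w - t) * (w * t - 1) = 0 := by
        field_simp at hwt
        linear_combination hwt
      rcases mul_eq_zero.mp hprod with h | h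
      · rw [sub_eq_zero.mp h] at hGw
        exact hGw hGt
      · have h2 := congrArg norm (sub_eq_zero.mp h)
        rw [norm_mul, norm_one] at h2
        have h3 : ‖w‖ < 1 := by simpa using hwb
        have h4 : ‖t‖ < 1 := by simpa using ht
        nlinarith [norm_nonneg w, norm_nonneg t]
    rw [mem_derivedSet, accPt_iff_frequently] at hlam
    exact hlam (hev'.mono fun mu h h' => h h'.1 h'.2)

/-! ### Spectral singularities. -/

theorem spectralSingularities_eq_image {a p q : ℤ → ℂ} {G : ℂ → ℂ}
    (hPhi : ∀ z : ℂ, 0 ≤ z.im → (Phi a p q z = 0 ↔ G (Complex.exp (Complex.I * z / 2)) = 0)) :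
    spectralSingularities a p q =
      (fun s : ℂ => 2 * s.re) '' {s ∈ sphere (0 : ℂ) 1 | G s = 0} := by
  have hexp : ∀ x : ℝ, Complex.exp (Complex.I * x / 2) = circleMap 0 1 (x / 2) := fun x => by
    simp only [circleMap, Complex.ofReal_one, one_mul, zero_add]
    congr 1; push_cast; ring
  have hre : ∀ x : ℝ, (circleMap 0 1 x).re = Real.cos x := fun x => by
    simp [circleMap, Complex.exp_ofReal_mul_I_re]
  ext lam
  constructor
  · rintro ⟨z, -, rfl, hz⟩
    rw [hPhi _ (by simp), hexp] at hz
    exact ⟨_, ⟨by simp, hz⟩, by simp only [hre]⟩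
  · rintro ⟨s, ⟨hs, hGs⟩, rfl⟩
    have hs1 : s = circleMap 0 1 s.arg := by
      have := Complex.norm_mul_exp_arg_mul_I s
      rw [mem_sphere_zero_iff_norm.mp hs] at this
      simpa [circleMap] using this.symm
    have hpi := Real.pi_pos
    have h1 := Complex.neg_pi_lt_arg s
    have h2 := Complex.arg_le_pi s
    have key : ∀ x : ℝ, circleMap 0 1 x = s → 2 * x ∈ Set.Icc (-Real.pi) (3 * Real.pi) →
        2 * s.re ∈ spectralSingularities a p q := fun x hx hmem => by
      refine ⟨2 * x, hmem, ?_, ?_⟩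
      · rw [mul_div_cancel_left₀ _ two_ne_zero, ← hre, hx]
      · rw [hPhi _ (by simp), hexp, mul_div_cancel_left₀ _ two_ne_zero, hx, hGs]
    -- The range of `z / 2` is `[-π/2, 3π/2]`, whereas `arg` lies in `(-π, π]`; arguments up to
    -- `-π/2` are shifted by one turn.
    rcases le_total (-(Real.pi / 2)) s.arg with h | h
    · exact key s.arg hs1.symm ⟨by linarith, by linarith⟩
    · refine key (s.arg + 2 * Real.pi) ?_ ⟨by linarith, by linarith⟩
      rw [periodic_circleMap, ← hs1]

theorem isClosed_image_circle_zeros {G : ℂ → ℂ} (hG : DiffContOnCl ℂ G (ball 0 1)) :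
    IsClosed ((fun s : ℂ => 2 * s.re) '' {s ∈ sphere (0 : ℂ) 1 | G s = 0}) := by
  have hc : IsClosed {s ∈ sphere (0 : ℂ) 1 | G s = 0} :=
    (hG.continuousOn_ball.mono sphere_subset_closedBall).preimage_isClosed_of_isClosed
      isClosed_sphere isClosed_singleton
  have : IsCompact {s ∈ sphere (0 : ℂ) 1 | G s = 0} :=
    (isCompact_sphere (0 : ℂ) 1).of_isClosed_subset hc fun s hs => hs.1
  exact (this.image (by fun_prop)).isClosed

/-- The differentiable map `θ ↦ 2 cos θ` sends null sets to null sets. -/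
theorem volume_image_circle_zeros {G : ℂ → ℂ} (hG : DiffContOnCl ℂ G (ball 0 1)) (h0 : G 0 ≠ 0) :
    volume ((fun s : ℂ => 2 * s.re) '' {s ∈ sphere (0 : ℂ) 1 | G s = 0}) = 0 := by
  have hnull := volume_circle_zeros_eq_zero hG h0
  refine measure_mono_null ?_ (addHaar_image_eq_zero_of_differentiableOn_of_addHaar_eq_zero volume
    (f := fun θ : ℝ => 2 * Real.cos θ) (by fun_prop) hnull)
  rintro _ ⟨s, ⟨hs, hGs⟩, rfl⟩
  have : s ∈ circleMap 0 1 '' Set.Ioc 0 (2 * Real.pi) := by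
    rw [image_circleMap_Ioc]; simpa using hs
  obtain ⟨θ, hθ, rfl⟩ := this
  exact ⟨θ, ⟨hθ, hGs⟩, by simp [circleMap, Complex.exp_ofReal_mul_I_re]⟩

theorem spectralSingularitiesOffThresholds_subset (a p q : ℤ → ℂ) :
    spectralSingularitiesOffThresholds a p q ⊆ spectralSingularities a p q := by
  rintro lam ⟨z, hz, h⟩
  exact ⟨z, Set.Ioo_subset_Icc_self hz.1, h⟩

theorem spectralSingularities_subset (a p q : ℤ → ℂ) : spectralSingularities a p q ⊆
    spectralSingularitiesOffThresholds a p q ∪ {-2, 0, 2} := by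
  rintro lam ⟨z, hz, rfl, hP⟩
  by_cases h : z ∈ Set.Ioo (-Real.pi) (3 * Real.pi) \ {0, Real.pi, 2 * Real.pi}
  · exact Or.inl ⟨z, h, rfl, hP⟩
  · right
    -- The endpoints `-π` and `3π` also give `λ = 0`, so they add no further threshold.
    have hz' : z = -Real.pi ∨ z = 3 * Real.pi ∨ z = 0 ∨ z = Real.pi ∨ z = 2 * Real.pi := by
      by_contra hcon
      push Not at hcon
      exact h ⟨⟨hz.1.lt_of_ne' hcon.1, hz.2.lt_of_ne hcon.2.1⟩, by simp [hcon]⟩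
    rcases hz' with rfl | rfl | rfl | rfl | rfl
    · simp [neg_div]
    · have : Real.cos (3 * Real.pi / 2) = 0 := by
        rw [show 3 * Real.pi / 2 = Real.pi / 2 + Real.pi by ring, Real.cos_add_pi]; simp
      simp [this]
    · simp
    · simp
    · simp

theorem exists_mem_ball_of_notMem_Icc {lam : ℂ}
    (h : lam ∉ (fun x : ℝ => (x : ℂ)) '' Set.Icc (-2 : ℝ) 2) :
    ∃ s ∈ ball (0 : ℂ) 1, s ≠ 0 ∧ lam = s + s⁻¹ := by
  obtain ⟨z, hz, rfl⟩ := exists_two_mul_cos_half_eq lam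
  refine ⟨Complex.exp (Complex.I * z / 2), ?_, Complex.exp_ne_zero _, two_mul_cos_half z⟩
  have hz0 : 0 < z.im := hz.lt_of_ne' fun h0 => h ⟨2 * Real.cos (z.re / 2), ?_, ?_⟩
  · exact exp_half_mem_ball hz0
  · exact ⟨by linarith [Real.neg_one_le_cos (z.re / 2)], by linarith [Real.cos_le_one (z.re / 2)]⟩
  · have : z = (z.re : ℂ) := Complex.ext rfl (by simpa using h0)
    conv_rhs => rw [this]
    push_cast
    rfl

end DiffPencil

theorem lemma7 (a p q : ℤ → ℂ) (ha : ∀ n, a n ≠ 0)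
    (hsum : Summable fun n : ℤ => |(n : ℝ)| * (‖1 - a n‖ + ‖p n‖ + ‖q n‖)) :
    (Bornology.IsBounded (DiffPencil.eigenvalues a p q) ∧
      (DiffPencil.eigenvalues a p q).Countable ∧
      derivedSet (DiffPencil.eigenvalues a p q) ⊆
        (fun x : ℝ => (x : ℂ)) '' Set.Icc (-2 : ℝ) 2) ∧
    (IsClosed (DiffPencil.spectralSingularities a p q) ∧
      volume (DiffPencil.spectralSingularities a p q) = 0) ∧
    (closure (DiffPencil.spectralSingularitiesOffThresholds a p q) ⊆
        DiffPencil.spectralSingularitiesOffThresholds a p q ∪ {-2, 0, 2} ∧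
      volume (DiffPencil.spectralSingularitiesOffThresholds a p q) = 0) := by
  open DiffPencil in
  obtain ⟨-, G, hG, hG0, hPhi⟩ := exists_disc_function a p q ha hsum
  have hS : ∀ lam ∈ eigenvalues a p q,
      ∃ s ∈ Metric.ball (0 : ℂ) 1, s ≠ 0 ∧ lam = s + s⁻¹ ∧ G s = 0 := fun lam hlam => by
    obtain ⟨z, hz, rfl, hP⟩ := exists_zero_of_mem_eigenvalues ha hsum hlam
    exact ⟨_, exp_half_mem_ball hz, Complex.exp_ne_zero _, two_mul_cos_half z,
      (hPhi z hz.le).mp hP⟩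
  obtain ⟨hb, hc, hd⟩ := isBounded_countable_derivedSet hG hG0 hS
  have himage := spectralSingularities_eq_image hPhi
  have hclosed := isClosed_image_circle_zeros hG
  have hvol := volume_image_circle_zeros hG hG0
  rw [← himage] at hclosed hvol
  have hsub := spectralSingularitiesOffThresholds_subset a p q
  refine ⟨⟨hb, hc, fun lam hlam => ?_⟩, ⟨hclosed, hvol⟩, ?_, measure_mono_null hsub hvol⟩
  · by_contra hcon
    exact hd hlam (exists_mem_ball_of_notMem_Icc hcon)
  · exact (closure_minimal hsub hclosed).trans (spectralSingularities_subset a p q)
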